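/- Let $\mathbb{T}=\mathbb{R}\cup\{\infty\}$ with $\oplus=\min$ and $\odot=+$. A minimum of finitely many elements of $\mathbb{T}$ is said to be achieved twice if it is attained by at least two of the indices or if it equals $\infty$. Let $n,k\ge 0$, let $[2n]=\{1,\dots,n,\bar 1,\dots,\bar n\}$ with the involution $i\mapsto\bar i$, $\bar{\bar i}=i$, and write $Si=S\cup\{i\}$. Let $\mu=(\mu_B)_{B\in\binom{[2n]}{k}}$ be a valuated matroid of rank $k$ on $[2n]$, that is, a vector with entries in $\mathbb{T}$, not all equal to $\infty$, such that for all $S\in\binom{[2n]}{k-1}$ and $T\in\binom{[2n]}{k+1}$ the minimum in $\bigoplus_{i\in T\setminus S}\mu_{T\setminus i}\odot\mu_{Si}$ is achieved twice. Its tropical linear space is $$L_\mu=\Big\{x\in\mathbb{T}^{2n} \;\Big|\; \forall\, T\in\tbinom{[2n]}{k+1}:\ \text{the minimum in } \bigoplus_{i\in T}\mu_{T\setminus i}\odot x_i \text{ is achieved twice}\Big\}.$$ Call $L_\mu$ isotropic if for all $x,y\in L_\mu$ the minimum in $\bigoplus_{i\in[2n]}x_i\odot y_{\bar i}$ is achieved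 twice. Proposition. $L_\mu$ is isotropic if and only if for all $S_1,S_2\in\binom{[2n]}{k-1}$ the minimum in $$\bigoplus_{i\in[2n]}\mu_{S_1i}\odot\mu_{S_2\bar i}$$ is achieved twice, where $\mu_{S_1i}=\infty$ if $i\in S_1$ and $\mu_{S_2\bar i}=\infty$ if $\bar i\in S_2$. -/

import Mathlib

/-- The tropical semifield `ℝ ∪ {∞}`: here `+` is the minimum, `*` is the usual addition of
reals, `0` is `∞`, and `1` is the real number `0`. -/
abbrev TropicalNumbers : Type := Tropical (WithTop ℝ)

/-- The minimum in the tropical sum `⨁_{i ∈ s} f i` is achieved at least twice, or is `∞`.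
(The finite sum in `TropicalNumbers` is the minimum, and its `0` is `∞`.) -/
def MinAchievedTwice {ι : Type*} (s : Finset ι) (f : ι → TropicalNumbers) : Prop :=
  ∑ i ∈ s, f i = 0 ∨
    ∃ i ∈ s, ∃ j ∈ s, i ≠ j ∧ f i = ∑ l ∈ s, f l ∧ f j = ∑ l ∈ s, f l

/-- `μ` is a valuated matroid (tropical Plücker vector) of rank `k` on the ground set `E`.
A vector indexed by the `k`-subsets of `E` is encoded as a function on all finite subsets of `E`
that takes the value `∞` on every subset that does not have exactly `k` elements. -/
structure IsValuatedMatroid {E : Type*} [DecidableEq E] (k : ℕ)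
    (μ : Finset E → TropicalNumbers) : Prop where
  /-- The convention for subsets of the wrong size. -/
  eq_infty_of_card_ne : ∀ B : Finset E, B.card ≠ k → μ B = 0
  /-- Some coordinate is finite. -/
  exists_ne_infty : ∃ B : Finset E, μ B ≠ 0
  /-- The tropical Plücker relations. -/
  plucker : ∀ S T : Finset E, S.card + 1 = k → T.card = k + 1 →
    MinAchievedTwice (T \ S) (fun i => μ (T.erase i) * μ (insert i S))

/-- The tropical linear space `L_μ` of a rank `k` tropical Plücker vector `μ`. -/
def tropicalLinearSpace {E : Type*} [DecidableEq E] (k : ℕ)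
    (μ : Finset E → TropicalNumbers) : Set (E → TropicalNumbers) :=
  {x | ∀ T : Finset E, T.card = k + 1 → MinAchievedTwice T (fun i => μ (T.erase i) * x i)}

/-- The set `[2n] = {1, …, n, 1̄, …, n̄}`. -/
abbrev DoubledIndex (n : ℕ) : Type := Fin n ⊕ Fin n

/-- The involution `i ↦ ī` of `[2n]`. -/
def DoubledIndex.bar {n : ℕ} (i : DoubledIndex n) : DoubledIndex n := Sum.swap i

/-- Two points of `𝕋^{2n}` are tropically orthogonal if the minimum in `⨁_{i ∈ [2n]} x_i ⊙ y_ī`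
is achieved at least twice. -/
def TropicallyOrthogonal {n : ℕ} (x y : DoubledIndex n → TropicalNumbers) : Prop :=
  MinAchievedTwice Finset.univ (fun i => x i * y i.bar)

/-- A subset of `𝕋^{2n}` is isotropic if its points are pairwise tropically orthogonal. -/
def TropicallyIsotropic {n : ℕ} (L : Set (DoubledIndex n → TropicalNumbers)) : Prop :=
  ∀ x ∈ L, ∀ y ∈ L, TropicallyOrthogonal x y

/-! The vectors $(\mu_{Si})_i$ with $|S|=k-1$ lie in $L_\mu$ by the Plücker relations, so isotropy
yields the stated conditions. Conversely, these vectors tropically generate $L_\mu$, and a tropical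
hyperplane containing them contains $L_\mu$; applying this in each argument of the pairing proves
isotropy. Generation is the crux (`exists_le_mul_insert`). Given $x\in L_\mu$ and $x_i\ne\infty$,
take a basis $B\ni i$ minimizing $\mu_B-\sum_{j\in B}x_j$ and set $S=B\setminus i$. Comparing $B$
with $Sj$ gives $x_j\le(x_i-\mu_B)+\mu_{Sj}$, with equality at $j=i$. -/

/-- The real number underlying a tropical number, with the value `0` at `∞`. -/
noncomputable def TropicalNumbers.toReal (t : TropicalNumbers) : ℝ :=
  (Tropical.untrop t).untopD 0

/-- A real number as a tropical number. -/
noncomputable def TropicalNumbers.ofReal (r : ℝ) : TropicalNumbers :=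
  Tropical.trop (r : WithTop ℝ)

namespace TropicalNumbers

theorem ofReal_toReal {t : TropicalNumbers} (ht : t ≠ 0) : ofReal t.toReal = t := by
  obtain ⟨r, hr⟩ := WithTop.ne_top_iff_exists.mp
    (fun h : Tropical.untrop t = ⊤ => ht (Tropical.untrop_injective h))
  apply Tropical.untrop_injective
  simp [ofReal, toReal, ← hr]

theorem ofReal_mul (a b : ℝ) : ofReal a * ofReal b = ofReal (a + b) := rfl

theorem ofReal_le_ofReal {a b : ℝ} : ofReal a ≤ ofReal b ↔ a ≤ b := by
  rw [ofReal, ofReal, ← Tropical.untrop_le_iff]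
  exact WithTop.coe_le_coe

theorem le_zero' (t : TropicalNumbers) : t ≤ 0 :=
  Tropical.untrop_le_iff.mp le_top

end TropicalNumbers

open TropicalNumbers

/-- The minimum is achieved twice if and only if every finite term is bounded below by another
term. -/
theorem minAchievedTwice_iff {ι : Type*} (s : Finset ι) (f : ι → TropicalNumbers) :
    MinAchievedTwice s f ↔ ∀ i ∈ s, f i = 0 ∨ ∃ j ∈ s, j ≠ i ∧ f j ≤ f i := by
  have hsum : ∀ i ∈ s, ∑ l ∈ s, f l ≤ f i := fun i hi => by
    rw [← Tropical.untrop_le_iff, Finset.untrop_sum']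
    exact Finset.inf_le (f := Tropical.untrop ∘ f) hi
  constructor
  · rintro (h0 | ⟨i, hi, j, hj, hij, hfi, hfj⟩) l hl
    · exact Or.inl (le_antisymm (le_zero' _) (h0 ▸ hsum l hl))
    · refine Or.inr ?_
      by_cases hil : i = l
      · exact ⟨j, hj, fun h => hij (hil.trans h.symm), hfj ▸ hsum l hl⟩
      · exact ⟨i, hi, hil, hfi ▸ hsum l hl⟩
  · intro h
    rcases s.eq_empty_or_nonempty with rfl | hs
    · exact Or.inl Finset.sum_empty
    obtain ⟨i, hi, hmin⟩ := Finset.exists_mem_eq_inf s hs (Tropical.untrop ∘ f)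
    rw [← Finset.untrop_sum'] at hmin
    have hfi : f i = ∑ l ∈ s, f l := Tropical.untrop_injective hmin.symm
    rcases h i hi with h0 | ⟨j, hj, hji, hle⟩
    · exact Or.inl (hfi ▸ h0)
    · exact Or.inr ⟨i, hi, j, hj, hji.symm, hfi, le_antisymm (hfi ▸ hle) (hsum j hj)⟩

/-- The vectors `(μ_{Si})_i` lie in the tropical linear space. -/
theorem IsValuatedMatroid.insert_mem_tropicalLinearSpace {E : Type*} [DecidableEq E] {k : ℕ}
    {μ : Finset E → TropicalNumbers} (hμ : IsValuatedMatroid k μ) {S : Finset E}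
    (hS : S.card + 1 = k) : (fun i => μ (insert i S)) ∈ tropicalLinearSpace k μ := by
  intro T hT
  rw [minAchievedTwice_iff]
  intro i hi
  by_cases hiS : i ∈ S
  -- Here `insert i S` is `S`, of size $k-1$, so the term is $\infty$ by convention.
  · left
    beta_reduce
    rw [Finset.insert_eq_of_mem hiS, hμ.eq_infty_of_card_ne S (by omega), mul_zero]
  · rcases (minAchievedTwice_iff _ _).mp (hμ.plucker S T hS hT) i
      (Finset.mem_sdiff.mpr ⟨hi, hiS⟩) with h | ⟨j, hj, h⟩
    · exact Or.inl h
    · exact Or.inr ⟨j, (Finset.mem_sdiff.mp hj).1, h⟩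

/-- Every point `x` of the tropical linear space lies below a multiple of some vector
`(μ_{Sj})_j` that agrees with `x` at a prescribed index in the support of `x`. Thus `x` is a
tropical linear combination of these vectors. -/
theorem IsValuatedMatroid.exists_le_mul_insert {E : Type*} [DecidableEq E] [Fintype E] {k : ℕ}
    {μ : Finset E → TropicalNumbers} (hμ : IsValuatedMatroid k μ) {x : E → TropicalNumbers}
    (hx : x ∈ tropicalLinearSpace k μ) {i : E} (hi : x i ≠ 0) :
    ∃ S : Finset E, S.card + 1 = k ∧ ∃ c : TropicalNumbers,
      x i = c * μ (insert i S) ∧ ∀ j, x j ≤ c * μ (insert j S) := by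
  classical
  have hcard : ∀ B, μ B ≠ 0 → B.card = k := fun B hB => by
    by_contra h
    exact hB (hμ.eq_infty_of_card_ne B h)
  let w : E → ℝ := fun j => (x j).toReal
  -- Lexicographic order lets $x_j=\infty$ outweigh every finite coordinate: bases with more such
  -- $j$ come first. The default `w j = 0` there is harmless, since `w` is only compared at finite
  -- coordinates.
  let d : E → ℤ := fun j => if x j = 0 then -1 else 0
  let key : Finset E → ℤ ×ₗ ℝ := fun B => toLex (∑ j ∈ B, d j, (μ B).toReal - ∑ j ∈ B, w j)
  -- an exchange of one element changes the key by the exchanged weights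
  have hkey : ∀ (S : Finset E) (a b : E), a ∉ S → b ∉ S →
      (key (insert a S) ≤ key (insert b S) ↔ d a < d b ∨ d a = d b ∧
        (μ (insert a S)).toReal - w a ≤ (μ (insert b S)).toReal - w b) := by
    intro S a b ha hb
    simp only [key, Prod.Lex.toLex_le_toLex, Finset.sum_insert ha, Finset.sum_insert hb]
    refine or_congr (by constructor <;> intro <;> linarith)
      (and_congr (by constructor <;> intro <;> linarith) (by constructor <;> intro <;> linarith))
  have hd : d i = 0 := if_neg hi
  -- a minimal basis, which may be chosen to contain `i`
  obtain ⟨B, hB, hiB, hmin⟩ : ∃ B, μ B ≠ 0 ∧ i ∈ B ∧ ∀ C, μ C ≠ 0 → key B ≤ key C := by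
    obtain ⟨A, hA⟩ := hμ.exists_ne_infty
    obtain ⟨B, hB, hmin⟩ := Finset.exists_min_image (Finset.univ.filter fun B => μ B ≠ 0) key
      ⟨A, by simpa using hA⟩
    have hB : μ B ≠ 0 := by simpa using hB
    have hmin : ∀ C, μ C ≠ 0 → key B ≤ key C := fun C hC => hmin C (by simpa using hC)
    by_cases hiB : i ∈ B
    · exact ⟨B, hB, hiB, hmin⟩
    -- If $i\notin B$, the relation of $x$ at $T=B\cup i$ gives a $j\in B$ with $x_j$ finite such
    -- that exchanging $j$ for $i$ does not increase the key.
    rcases (minAchievedTwice_iff _ _).mp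
      (hx (insert i B) (by rw [Finset.card_insert_of_notMem hiB, hcard B hB])) i
      (Finset.mem_insert_self i B) with h | ⟨j, hj, hji, hle⟩
    · rw [Finset.erase_insert hiB] at h
      exact absurd h (mul_ne_zero hB hi)
    have hjB : j ∈ B := (Finset.mem_insert.mp hj).resolve_left hji
    rw [Finset.erase_insert hiB, Finset.erase_insert_of_ne hji.symm] at hle
    have hne : μ (insert i (B.erase j)) * x j ≠ 0 := fun h =>
      mul_ne_zero hB hi (le_antisymm (le_zero' _) (h ▸ hle))
    have hC := left_ne_zero_of_mul hne
    have hj := right_ne_zero_of_mul hne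
    refine ⟨_, hC, Finset.mem_insert_self _ _, fun C hC' => le_trans ?_ (hmin C hC')⟩
    rw [← ofReal_toReal hC, ← ofReal_toReal hj, ← ofReal_toReal hB, ← ofReal_toReal hi,
      ofReal_mul, ofReal_mul, ofReal_le_ofReal] at hle
    have := (hkey (B.erase j) i j (fun h => hiB (Finset.mem_of_mem_erase h))
      (Finset.notMem_erase j B)).mpr (Or.inr ⟨hd.trans (if_neg hj).symm, by
        rw [Finset.insert_erase hjB]
        simp only [w]
        linarith⟩)
    rwa [Finset.insert_erase hjB] at this
  have hins := Finset.insert_erase hiB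
  have hSk : (B.erase i).card + 1 = k := (Finset.card_erase_add_one hiB).trans (hcard B hB)
  refine ⟨B.erase i, hSk, ofReal (w i - (μ B).toReal), ?_, fun j => ?_⟩
  · have h := ofReal_mul (w i - (μ B).toReal) (μ B).toReal
    rw [sub_add_cancel, ofReal_toReal hi, ofReal_toReal hB] at h
    rw [hins, h]
  · by_cases h0 : μ (insert j (B.erase i)) = 0
    · rw [h0, mul_zero]
      exact le_zero' _
    have hjS : j ∉ B.erase i := fun h => by
      have := hcard _ h0
      rw [Finset.insert_eq_of_mem h] at this
      omega
    have hk := (hkey (B.erase i) i j (Finset.notMem_erase i B) hjS).mp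
      (by rw [hins]; exact hmin _ h0)
    rw [hd, hins] at hk
    by_cases hxj : x j = 0
    -- If $x_j=\infty$, replacing $i$ by $j$ would lower the key, contradicting minimality.
    · have : d j = -1 := if_pos hxj
      omega
    have hdj : d j = 0 := if_neg hxj
    have hle := (hk.resolve_left (by omega)).2
    rw [← ofReal_toReal h0, ofReal_mul, ← ofReal_toReal hxj, ofReal_le_ofReal]
    simp only [w] at hle ⊢
    linarith

/-- A tropical hyperplane that contains all the vectors `(μ_{Si})_i` contains the tropical linear
space. -/
theorem IsValuatedMatroid.minAchievedTwice_mul {E : Type*} [DecidableEq E] [Fintype E] {k : ℕ}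
    {μ : Finset E → TropicalNumbers} (hμ : IsValuatedMatroid k μ) {a : E → TropicalNumbers}
    (ha : ∀ S : Finset E, S.card + 1 = k →
      MinAchievedTwice Finset.univ (fun i => μ (insert i S) * a i))
    {x : E → TropicalNumbers} (hx : x ∈ tropicalLinearSpace k μ) :
    MinAchievedTwice Finset.univ (fun i => x i * a i) := by
  rw [minAchievedTwice_iff]
  intro i _
  by_cases h0 : x i * a i = 0
  · exact Or.inl h0
  -- The chosen multiple dominates $x$ and touches it at $i$, so a term competing with its $i$-th
  -- term also competes for $x$.
  obtain ⟨S, hS, c, hc, hle⟩ := hμ.exists_le_mul_insert hx (left_ne_zero_of_mul h0)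
  rcases (minAchievedTwice_iff _ _).mp (ha S hS) i (Finset.mem_univ i) with h | ⟨j, hj, hji, h⟩
  · exact absurd (by rw [hc, mul_assoc, h, mul_zero]) h0
  · refine Or.inr ⟨j, hj, hji, ?_⟩
    calc x j * a j ≤ c * μ (insert j S) * a j := mul_le_mul_left (hle j) _
      _ = c * (μ (insert j S) * a j) := mul_assoc _ _ _
      _ ≤ c * (μ (insert i S) * a i) := mul_le_mul_right h _
      _ = x i * a i := by rw [hc, mul_assoc]

theorem DoubledIndex.bar_bar {n : ℕ} (i : DoubledIndex n) : i.bar.bar = i :=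
  Sum.swap_swap i

theorem TropicallyOrthogonal.symm {n : ℕ} {x y : DoubledIndex n → TropicalNumbers}
    (h : TropicallyOrthogonal x y) : TropicallyOrthogonal y x := by
  unfold TropicallyOrthogonal at h ⊢
  rw [minAchievedTwice_iff] at h ⊢
  intro i _
  rcases h i.bar (Finset.mem_univ _) with h | ⟨j, _, hji, hle⟩
  · rw [i.bar_bar, mul_comm] at h
    exact Or.inl h
  · refine Or.inr ⟨j.bar, Finset.mem_univ _, fun e => hji (e ▸ j.bar_bar.symm), ?_⟩
    rw [i.bar_bar, mul_comm, mul_comm (x i.bar)] at hle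
    rwa [j.bar_bar]

theorem mainTheorem8 (n k : ℕ) (μ : Finset (DoubledIndex n) → TropicalNumbers)
    (hμ : IsValuatedMatroid k μ) :
    TropicallyIsotropic (tropicalLinearSpace k μ) ↔
      ∀ S₁ S₂ : Finset (DoubledIndex n), S₁.card + 1 = k → S₂.card + 1 = k →
        MinAchievedTwice Finset.univ
          (fun i : DoubledIndex n => μ (insert i S₁) * μ (insert i.bar S₂)) := by
  constructor
  · intro h S₁ S₂ h₁ h₂
    exact h _ (hμ.insert_mem_tropicalLinearSpace h₁) _ (hμ.insert_mem_tropicalLinearSpace h₂)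
  · intro h x hx y hy
    -- Reduce $x$ to the generators, then $y$, using symmetry of the pairing.
    refine hμ.minAchievedTwice_mul (a := fun i => y i.bar) (fun S hS => ?_) hx
    exact TropicallyOrthogonal.symm (x := y) (y := fun i => μ (insert i S))
      (hμ.minAchievedTwice_mul (fun S' hS' => h S' S hS' hS) hy)
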